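/- **Setting.** Let $0\le k\le n$, and let $X$ be the set of words of length $n$ in the alphabet $\{1,2\}$ in which the letter $1$ occurs exactly $k$ times (equivalently, the $k$-subsets of $\{1,\dots,n\}$). Let $\mathcal F$ be the space of complex functions on $X$, with the inner product for which the delta functions $\delta(x)$, $x\in X$, are orthonormal, and with the action $\sigma f=f\circ\sigma^{-1}$ of $S_n$, which permutes the places of words. For $j\le n$ let $S_j\subseteq S_n$ be the subgroup fixing $j+1,\dots,n$. For a Young diagram $\lambda$ with $j$ boxes and a representation $V$ of $S_m$, $m \ge j$, let $V_{j,\lambda}$ be the isotypic component of $V|_{S_j}$ for the irreducible representation (Specht module) of shape $\lambda$. A standard tableau $T$ with $m$ boxes is identified with the chain $\lambda_1\nearrow\dots\nearrow\lambda_m$ of Young diagrams, each obtained from the previous one by adding one box ($\lambda_j$ is formed by the boxes containing $1,\dots,j$); put $V_T=V_{1,\lambda_1}\cap\dots\cap V_{m,\lambda_m}$. A Gelfand–Tsetlin basis of a multiplicity-free representation $V$ of $S_m$ consists of one unit vector from each nonzero $V_T$. For a place $p$ and a letter $c$, let $\mathcal F^{p,c}$ be the span of the $\delta(x)$ such that $x$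 has the letter $c$ at the place $p$. For $0\le i\le n$ let $X_i$ be the set of words $w$ of length $n-i$ in $\{1,2\}$ in which $1$ occurs at most $k$ times. For $w\in X_i$ let $\mathcal F^w$ be the span of the $\delta(x)$ with $x\in X$ ending in $w$; it is a multiplicity-free representation of $S_i$. Let $B^w$ be a Gelfand–Tsetlin basis of $\mathcal F^w$ and $B_i=\bigsqcup_{w\in X_i}B^w$. The label of $b\in B_i$ is the pair $(T,w)$ with $b\in\mathcal F^w_T$; here $w\in X_i$, and $T$ is a standard tableau of shape $(i-a,a)$ with $0\le a\le\min(r,i-r)$, where $k-r$ is the number of letters $1$ in $w$. Let $1\le i\le n$, $b\in B_{i-1}$ and $b'\in B_i$. * $b$ and $b'$ are *related* if both belong to $$\mathcal F_{1,\lambda_1}\cap\dots\cap\mathcal F_{i-1,\lambda_{i-1}}\cap\mathcal F^{i+1,c_{i+1}}\cap\dots\cap\mathcal F^{n,c_n}$$ for some Young diagrams $\lambda_1,\dots,\lambda_{i-1}$ ($\lambda_j$ with $j$ boxes) and some letters $c_{i+1},\dots,c_n\in\{1,2\}$. * A label $(Q,w)$ determines a triple $(P,Q,w)$, where $P$ is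 the semistandard tableau with entries in $\{1,2\}$ that has the shape of $Q$ and for which the letter $1$ occurs $k$ times in $P$ and $w$ together. The Robinson–Schensted insertion step sends $(P,Q,cw')$, with $c$ the first letter of the word, to $(P',Q',w')$, where $P'$ is obtained by row insertion of $c$ into $P$ and $Q'$ is obtained from $Q$ by putting $i$ into the box that was added to the shape. $b$ and $b'$ are *RS-related* if the label of $b'$ is obtained in this way from the label of $b$. **Theorem.** If $b\in B_{i-1}$ and $b'\in B_i$ are RS-related, then they are related. -/

import Mathlib

noncomputable section

namespace Johnson

/-! ### Isotypic components of a representation -/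

/-- The isotypic component of type `σ` in `ρ`: the sum of all subrepresentations of `ρ` that are
isomorphic to `σ`. -/
def isotypic {G V W : Type*} [Group G] [AddCommMonoid V] [Module ℂ V]
    [AddCommMonoid W] [Module ℂ W]
    (ρ : Representation ℂ G V) (σ : Representation ℂ G W) : Submodule ℂ V :=
  ⨆ U : {U : Subrepresentation ρ // Nonempty (U.toRepresentation.Equiv σ)}, U.1.toSubmodule

/-! ### The irreducible representation of `S_m` attached to a Young diagram (Specht module) -/

/-- `S_m` acting on the space with basis the functions `f : {1,…,m} → ℕ`, by `σ · f = f ∘ σ⁻¹`.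
A tabloid is recorded as the function that sends each number to the index of its row. -/
def tabloidRep (m : ℕ) : Representation ℂ (Equiv.Perm (Fin m)) ((Fin m → ℕ) →₀ ℂ) where
  toFun σ := Finsupp.lmapDomain ℂ ℂ (fun f : Fin m → ℕ => f ∘ ⇑σ⁻¹)
  map_one' := by
    apply Finsupp.lhom_ext
    intro f c
    simp [Finsupp.lmapDomain_apply, Finsupp.mapDomain_single]
  map_mul' σ τ := by
    apply Finsupp.lhom_ext
    intro f c
    simp [Finsupp.lmapDomain_apply, Finsupp.mapDomain_single, Function.comp_assoc]

/-- The polytabloid of a bijective filling `t` of the diagram `μ`: the signed sum, over all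
permutations `π` of the cells that preserve every column, of the tabloid of `π ∘ t`. -/
def polytabloid {m : ℕ} (μ : YoungDiagram) (t : Fin m ≃ μ.cells) : (Fin m → ℕ) →₀ ℂ :=
  ∑ π : Equiv.Perm μ.cells with ∀ c, (π c).1.2 = c.1.2,
    Finsupp.single (fun x => (π (t x)).1.1) ((Equiv.Perm.sign π : ℤ) : ℂ)

/-- The span of all polytabloids of shape `μ`, as a subrepresentation. -/
def spechtSub (m : ℕ) (μ : YoungDiagram) : Subrepresentation (tabloidRep m) where
  toSubmodule := Submodule.span ℂ (Set.range (polytabloid (m := m) μ))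
  apply_mem_toSubmodule σ v hv := by
    have key : Submodule.span ℂ (Set.range (polytabloid (m := m) μ)) ≤
        (Submodule.span ℂ (Set.range (polytabloid (m := m) μ))).comap (tabloidRep m σ) := by
      rw [Submodule.span_le]
      rintro _ ⟨t, rfl⟩
      apply Submodule.subset_span
      refine ⟨σ.symm.trans t, ?_⟩
      simp only [polytabloid, map_sum]
      refine Finset.sum_congr rfl fun π _ => ?_
      simp only [tabloidRep, MonoidHom.coe_mk, OneHom.coe_mk, Finsupp.lmapDomain_apply,
        Finsupp.mapDomain_single]
      rfl
    exact key hv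

/-- The Specht module of `S_m` attached to a Young diagram `μ` with `m` boxes. -/
def specht (m : ℕ) (μ : YoungDiagram) :
    Representation ℂ (Equiv.Perm (Fin m)) (spechtSub m μ).toSubmodule :=
  (spechtSub m μ).toRepresentation

/-- The inclusion `S_j ⊆ S_m`: permutations fixing the last `m - j` elements. -/
def symIncl {j m : ℕ} (h : j ≤ m) : Equiv.Perm (Fin j) →* Equiv.Perm (Fin m) :=
  Equiv.Perm.viaEmbeddingHom (Fin.castLEEmb h)

/-- `V_{j,μ}`: the isotypic component, for the Specht module of shape `μ`, of an
`S_m`-representation `V` regarded as an `S_j`-representation. -/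
def isoComp {m : ℕ} {V : Type*} [AddCommMonoid V] [Module ℂ V]
    (ρ : Representation ℂ (Equiv.Perm (Fin m)) V) {j : ℕ} (h : j ≤ m) (μ : YoungDiagram) :
    Submodule ℂ V :=
  isotypic (ρ.comp (symIncl h)) (specht j μ)

/-! ### Standard tableaux and Gelfand–Tsetlin bases -/

/-- A standard Young tableau with `m` boxes, given as a chain
`∅ = λ₀ ↗ λ₁ ↗ ⋯ ↗ λ_m` of Young diagrams, each obtained from the previous one by adding a box
(the box that contains the corresponding number). -/
structure StdTableau (m : ℕ) where
  chain : Fin (m + 1) → YoungDiagram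
  chain_zero : chain 0 = ⊥
  chain_le : ∀ j : Fin m, chain j.castSucc ≤ chain j.succ
  chain_card : ∀ j : Fin m, (chain j.succ).card = (chain j.castSucc).card + 1

/-- The shape of a standard tableau. -/
def StdTableau.shape {m : ℕ} (T : StdTableau m) : YoungDiagram := T.chain (Fin.last m)

/-- The Gelfand–Tsetlin subspace `V_T = V_{1,λ₁} ∩ ⋯ ∩ V_{m,λ_m}` of an `S_m`-representation. -/
def gtSpace {m : ℕ} {V : Type*} [AddCommMonoid V] [Module ℂ V]
    (ρ : Representation ℂ (Equiv.Perm (Fin m)) V) (T : StdTableau m) : Submodule ℂ V :=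
  ⨅ j : Fin m, isoComp ρ (Nat.succ_le_of_lt j.isLt) (T.chain j.succ)

/-- `B` is a Gelfand–Tsetlin basis of the (multiplicity-free) `S_m`-representation `V`: it is
obtained by choosing one unit vector in each nonzero space `V_T`. -/
def IsGTBasis {m : ℕ} {V : Type*} [NormedAddCommGroup V] [InnerProductSpace ℂ V]
    (ρ : Representation ℂ (Equiv.Perm (Fin m)) V) (B : Set V) : Prop :=
  ∃ v : {T : StdTableau m // gtSpace ρ T ≠ ⊥} → V,
    (∀ T, v T ∈ gtSpace ρ T.1 ∧ ‖v T‖ = 1) ∧ B = Set.range v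

/-! ### The function space on the Johnson graph -/

/-- The alphabet `{1, 2}`. -/
abbrev Letter : Type := {c : ℕ // c ∈ Finset.Icc 1 2}

/-- The number of occurrences of the letter `1`. -/
def ones (w : List Letter) : ℕ := w.countP (fun c : Letter => c.1 = 1)

/-- The set `X` of `k`-sets in `{1,…,n}`, as words of length `n` in which the letter `1`
occurs `k` times. -/
abbrev Word (n k : ℕ) : Type := {x : Fin n → Letter // ones (List.ofFn x) = k}

/-- The action of `S_n` on words: the letter of `σ x` at the place `σ p` is that of `x` at `p`. -/
def permWord {n k : ℕ} (σ : Equiv.Perm (Fin n)) (x : Word n k) : Word n k :=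
  ⟨x.1 ∘ ⇑σ⁻¹, by
    refine Eq.trans ?_ x.2
    unfold ones
    exact (Equiv.Perm.ofFn_comp_perm σ⁻¹ x.1).countP_eq _⟩

theorem permWord_one {n k : ℕ} (x : Word n k) : permWord 1 x = x := rfl

theorem permWord_mul {n k : ℕ} (σ τ : Equiv.Perm (Fin n)) (x : Word n k) :
    permWord (σ * τ) x = permWord σ (permWord τ x) := by
  apply Subtype.ext
  funext p
  simp [permWord]

/-- The space `𝓕` of complex functions on `X`, with the inner product for which the delta
functions are orthonormal. -/
abbrev FunSpace (n k : ℕ) : Type := EuclideanSpace ℂ (Word n k)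

/-- The delta function at a word. -/
def delta {n k : ℕ} (x : Word n k) : FunSpace n k := EuclideanSpace.single x 1

/-- The representation of `S_n` on `𝓕`, `σ f = f ∘ σ⁻¹`. -/
def funRep (n k : ℕ) : Representation ℂ (Equiv.Perm (Fin n)) (FunSpace n k) where
  toFun σ :=
    { toFun := fun f => WithLp.toLp 2 (fun x => f (permWord σ⁻¹ x))
      map_add' := fun f g => by ext x; simp
      map_smul' := fun c f => by ext x; simp }
  map_one' := by
    ext f x
    simp [permWord_one]
  map_mul' σ τ := by
    ext f x
    simp [permWord_mul]

/-- `𝓕^{p,c}`: the span of the delta functions of the words with the letter `c` at the place `p`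
(places are numbered from `0`). -/
def letterSpace (n k : ℕ) (p : Fin n) (c : Letter) : Submodule ℂ (FunSpace n k) :=
  Submodule.span ℂ (delta '' {x : Word n k | x.1 p = c})

/-- `X_i`: words of length `n - i` in which the letter `1` occurs at most `k` times. -/
abbrev SuffixWord (n k i : ℕ) : Type := {w : List Letter // w.length + i = n ∧ ones w ≤ k}

/-- `X^w`: the words in `X` of the form `w' w`. -/
def wordsEndingIn {n k i : ℕ} (w : SuffixWord n k i) : Set (Word n k) :=
  {x | w.1 <:+ List.ofFn x.1}

/-- `𝓕^w`: the span of the delta functions of the words in `X^w`. -/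
def suffixSpace {n k i : ℕ} (w : SuffixWord n k i) : Submodule ℂ (FunSpace n k) :=
  Submodule.span ℂ (delta '' wordsEndingIn w)

theorem SuffixWord.le {n k i : ℕ} (w : SuffixWord n k i) : i ≤ n := by
  have := w.2.1
  omega

theorem symIncl_inv_apply_of_le {j m : ℕ} (h : j ≤ m) (σ : Equiv.Perm (Fin j)) (p : Fin m)
    (hp : j ≤ p.val) : (symIncl h σ)⁻¹ p = p := by
  rw [← map_inv]
  apply Equiv.Perm.viaEmbedding_apply_of_notMem
  rintro ⟨q, rfl⟩
  have := q.isLt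
  simp at hp
  omega

theorem permWord_mem {n k i : ℕ} (w : SuffixWord n k i) (σ : Equiv.Perm (Fin i))
    (x : Word n k) (hx : x ∈ wordsEndingIn w) :
    permWord (symIncl (SuffixWord.le w) σ) x ∈ wordsEndingIn w := by
  have hw := w.2.1
  have hn : n - w.1.length = i := by omega
  simp only [wordsEndingIn, Set.mem_ofPred_eq, List.suffix_iff_eq_drop, List.length_ofFn, hn]
    at hx ⊢
  refine hx.trans (List.ext_getElem (by simp) fun t h1 h2 => ?_)
  simp only [List.getElem_drop, List.getElem_ofFn, permWord, Function.comp_apply]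
  rw [symIncl_inv_apply_of_le]
  simp

theorem funRep_delta {n k : ℕ} (σ : Equiv.Perm (Fin n)) (x : Word n k) :
    funRep n k σ (delta x) = delta (permWord σ x) := by
  ext y
  have h : permWord σ⁻¹ y = x ↔ y = permWord σ x := by
    constructor
    · rintro rfl
      simp [← permWord_mul, permWord_one]
    · rintro rfl
      simp [← permWord_mul, permWord_one]
  simp only [funRep, delta, MonoidHom.coe_mk, OneHom.coe_mk, LinearMap.coe_mk, AddHom.coe_mk]
  simp [h]

/-- `𝓕^w` is stable under `S_i`. -/
def suffixSub {n k i : ℕ} (w : SuffixWord n k i) :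
    Subrepresentation ((funRep n k).comp (symIncl (SuffixWord.le w))) where
  toSubmodule := suffixSpace w
  apply_mem_toSubmodule σ v hv := by
    have key : suffixSpace w ≤
        (suffixSpace w).comap ((funRep n k).comp (symIncl (SuffixWord.le w)) σ) := by
      conv_lhs => rw [suffixSpace]
      rw [Submodule.span_le]
      rintro _ ⟨x, hx, rfl⟩
      apply Submodule.subset_span
      exact ⟨_, permWord_mem w σ x hx, (funRep_delta _ x).symm⟩
    exact key hv

/-- The representation of `S_i` on `𝓕^w`. -/
def suffixRep {n k i : ℕ} (w : SuffixWord n k i) :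
    Representation ℂ (Equiv.Perm (Fin i)) (suffixSpace w) :=
  (suffixSub w).toRepresentation

/-- `B` is an `i`-th intermediate basis `B_i = ⨆_w B^w` of `𝓕`, where `B^w` is a Gelfand–Tsetlin
basis of the `S_i`-representation `𝓕^w` and `w` runs over `X_i`. -/
def IsIntermediateBasis (n k i : ℕ) (B : Set (FunSpace n k)) : Prop :=
  ∃ Bw : (w : SuffixWord n k i) → Set (suffixSpace w),
    (∀ w, IsGTBasis (suffixRep w) (Bw w)) ∧ B = ⋃ w, Subtype.val '' Bw w

/-! ### Labels, and the relation between consecutive bases -/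

/-- The labels of the elements of `B_i`: a word `w ∈ X_i` and a standard tableau of shape
`(i - a, a)` with `0 ≤ a ≤ min (r, i - r)`, where `k - r` is the number of letters `1` in `w`. -/
structure Label (n k i : ℕ) where
  tableau : StdTableau i
  word : SuffixWord n k i
  shape_eq : ∃ r a : ℕ, ones word.1 + r = k ∧ r ≤ i ∧ a ≤ min r (i - r) ∧
    tableau.shape.rowLen 0 = i - a ∧ tableau.shape.rowLen 1 = a ∧ tableau.shape.rowLen 2 = 0

/-- The label of `b` is `(T, w)`: the vector `b` lies in the Gelfand–Tsetlin subspace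
`𝓕^w_T` of `𝓕^w`. -/
def HasLabel {n k i : ℕ} (b : FunSpace n k) (l : Label n k i) : Prop :=
  b ∈ (gtSpace (suffixRep l.word) l.tableau).map (suffixSpace l.word).subtype

/-- Vectors `b ∈ B_i` and `b' ∈ B_{i+1}` are related: both belong to
`𝓕_{1,λ₁} ∩ ⋯ ∩ 𝓕_{i,λ_i} ∩ 𝓕^{i+2,c_{i+2}} ∩ ⋯ ∩ 𝓕^{n,c_n}` for some Young diagrams `λ_j` with
`j` boxes and some letters `c_p`. (Here `j + 1` runs over `1,…,i`, and `p + 1` over `i+2,…,n`.) -/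
def Related {n k i : ℕ} (hi : i + 1 ≤ n) (b b' : FunSpace n k) : Prop :=
  ∃ (d : Fin i → YoungDiagram) (c : Fin n → Letter), (∀ j, (d j).card = j.val + 1) ∧
    ∀ v ∈ ({b, b'} : Set (FunSpace n k)),
      (∀ j : Fin i, v ∈ isoComp (funRep n k) (j := j.val + 1) (by omega) (d j)) ∧
      (∀ p : Fin n, i + 1 ≤ p.val → v ∈ letterSpace n k p (c p))

/-! ### Robinson–Schensted insertion -/

/-- Inserting `x` into a weakly increasing row: `x` replaces the leftmost entry larger than `x`,
which is bumped out (second component), or is appended at the end if there is no such entry. -/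
def rowInsert (x : ℕ) : List ℕ → List ℕ × Option ℕ
  | [] => ([x], none)
  | y :: ys => if x < y then (x :: ys, some y)
      else (y :: (rowInsert x ys).1, (rowInsert x ys).2)

/-- Row insertion of `x` into a tableau given by the list of its rows: an entry bumped out of a
row is inserted into the next row. -/
def rsInsert (x : ℕ) : List (List ℕ) → List (List ℕ)
  | [] => [[x]]
  | R :: Rs => (rowInsert x R).1 ::
      match (rowInsert x R).2 with
      | none => Rs
      | some y => rsInsert y Rs

/-- The list of rows of a semistandard tableau. -/
def rows {μ : YoungDiagram} (P : SemistandardYoungTableau μ) : List (List ℕ) :=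
  (List.range (μ.colLen 0)).map fun r => (List.range (μ.rowLen r)).map fun c => P r c

/-- `P` is the semistandard tableau, filled with `1` and `2`, that completes the pair `(Q, w)` to
a triple `(P, Q, w)`: it has the shape of `Q`, and the letter `1` occurs `k` times in `P` and `w`
together. -/
def Completes {n k i : ℕ} (l : Label n k i) (P : SemistandardYoungTableau l.tableau.shape) :
    Prop :=
  (∀ c ∈ l.tableau.shape.cells, P c.1 c.2 = 1 ∨ P c.1 c.2 = 2) ∧
    (rows P).flatten.count 1 + ones l.word.1 = k

/-- One Robinson–Schensted insertion step `(P, Q, c w') ↦ (P', Q', w')`: `P'` is the result of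
inserting `c` into `P`, and `Q'` is obtained from `Q` by putting the number `i + 1` into the box
that has been added to the shape. -/
def RSStep {n k i : ℕ} (l : Label n k i) (l' : Label n k (i + 1)) : Prop :=
  ∃ (P : SemistandardYoungTableau l.tableau.shape)
    (P' : SemistandardYoungTableau l'.tableau.shape) (c : Letter),
    Completes l P ∧ Completes l' P' ∧ l.word.1 = c :: l'.word.1 ∧
      rows P' = rsInsert c (rows P) ∧
      ∀ j : Fin (i + 1), l'.tableau.chain j.castSucc = l.tableau.chain j

/-- Vectors `b ∈ B_i` and `b' ∈ B_{i+1}` are RS-related: the label of `b'` is obtained from the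
label of `b` by one Robinson–Schensted insertion step. -/
def RSRelated {n k : ℕ} (i : ℕ) (b b' : FunSpace n k) : Prop :=
  ∃ (l : Label n k i) (l' : Label n k (i + 1)), HasLabel b l ∧ HasLabel b' l' ∧ RSStep l l'

end Johnson

end

namespace Johnson

/-! Relatedness of $b$ and $b'$ asks only for common types under $S_1,\dots,S_i$ and common letters
at the places after $i+1$. Both can be read off the labels $(Q,cw')$ and $(Q',w')$: the chain of
$Q'$ begins with that of $Q$, and the two words agree beyond place $i+1$. So the diagrams of $Q$ and
the letters of $w'$ serve for both vectors. It remains to pass from $\mathcal F^w$ to $\mathcal F$.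
The inclusion is injective and commutes with every $S_j$ that acts on $\mathcal F^w$, so it respects
isotypic components (`map_isotypic_le`, `HasLabel.mem_isoComp`); and $\mathcal F^w$ is spanned by
deltas of words ending in $w$, which fixes the letters (`suffixSpace_le_letterSpace`). -/

/-- An injective intertwining map sends each isotypic component into the isotypic component of
the same type. -/
theorem map_isotypic_le {G V V' W : Type*} [Group G] [AddCommMonoid V] [Module ℂ V]
    [AddCommMonoid V'] [Module ℂ V'] [AddCommMonoid W] [Module ℂ W]
    {ρ : Representation ℂ G V} {ρ' : Representation ℂ G V'} (σ : Representation ℂ G W)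
    (f : V →ₗ[ℂ] V') (hf : Function.Injective f) (hρ : ∀ g v, f (ρ g v) = ρ' g (f v)) :
    (isotypic ρ σ).map f ≤ isotypic ρ' σ := by
  rw [isotypic, Submodule.map_iSup]
  refine iSup_le fun ⟨U, ⟨e⟩⟩ => ?_
  let U' : Subrepresentation ρ' :=
    { toSubmodule := U.toSubmodule.map f
      apply_mem_toSubmodule := by
        rintro g _ ⟨u, hu, rfl⟩
        exact ⟨ρ g u, U.apply_mem_toSubmodule g hu, hρ g u⟩ }
  -- Injectivity of `f` makes its restriction to `U` an isomorphism onto the image, so the image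
  -- still has type `σ`.
  let φ : U.toRepresentation.Equiv U'.toRepresentation :=
    .mk (Submodule.equivMapOfInjective f hf U.toSubmodule) fun g => by
      ext u
      exact hρ g u
  exact le_iSup
    (fun U : {U : Subrepresentation ρ' // Nonempty (U.toRepresentation.Equiv σ)} =>
      U.1.toSubmodule) ⟨U', ⟨φ.symm.trans e⟩⟩

theorem symIncl_apply_castLE {j m : ℕ} (h : j ≤ m) (σ : Equiv.Perm (Fin j)) (q : Fin j) :
    symIncl h σ (Fin.castLE h q) = Fin.castLE h (σ q) :=
  Equiv.Perm.viaEmbedding_apply σ (Fin.castLEEmb h) q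

theorem symIncl_apply_of_le {j m : ℕ} (h : j ≤ m) (σ : Equiv.Perm (Fin j)) (p : Fin m)
    (hp : j ≤ p.val) : symIncl h σ p = p := by
  simpa using symIncl_inv_apply_of_le h σ⁻¹ p hp

/-- The inclusions of symmetric groups compose. -/
theorem symIncl_symIncl {j m n : ℕ} (h : j ≤ m) (h' : m ≤ n) (σ : Equiv.Perm (Fin j)) :
    symIncl h' (symIncl h σ) = symIncl (h.trans h') σ := by
  ext p
  rcases lt_or_ge p.val m with hm | hm
  · obtain ⟨q, rfl⟩ : ∃ q : Fin m, Fin.castLE h' q = p := ⟨⟨p, hm⟩, rfl⟩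
    rw [symIncl_apply_castLE]
    rcases lt_or_ge q.val j with hj | hj
    · obtain ⟨r, rfl⟩ : ∃ r : Fin j, Fin.castLE h r = q := ⟨⟨q, hj⟩, rfl⟩
      rw [symIncl_apply_castLE, Fin.castLE_castLE, Fin.castLE_castLE, symIncl_apply_castLE]
    · rw [symIncl_apply_of_le h σ q hj, symIncl_apply_of_le (h.trans h') σ (Fin.castLE h' q) hj]
  · rw [symIncl_apply_of_le h' _ p hm, symIncl_apply_of_le _ σ p (h.trans hm)]

/-- The `S_j`-isotypic components of `𝓕^w` lie in those of `𝓕`. -/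
theorem map_isoComp_suffixRep_le {n k i j : ℕ} (w : SuffixWord n k i) (h : j ≤ i)
    (μ : YoungDiagram) :
    (isoComp (suffixRep w) h μ).map (suffixSpace w).subtype ≤
      isoComp (funRep n k) (h.trans w.le) μ := by
  refine map_isotypic_le _ _ (Submodule.subtype_injective _) fun σ v => ?_
  -- The action on $\mathcal F^w$ is by definition that of $\mathcal F$ restricted along
  -- $S_i\subseteq S_n$, so equivariance reduces to the equality of two embeddings $S_j\to S_n$.
  change funRep n k (symIncl w.le (symIncl h σ)) v = funRep n k (symIncl (h.trans w.le) σ) v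
  rw [symIncl_symIncl]

/-- A vector with label `(T, w)` lies in the isotypic components of `𝓕` given by `T`. -/
theorem HasLabel.mem_isoComp {n k i : ℕ} {b : FunSpace n k} {l : Label n k i}
    (hb : HasLabel b l) (j : Fin i) :
    b ∈ isoComp (funRep n k) ((Nat.succ_le_of_lt j.isLt).trans l.word.le)
      (l.tableau.chain j.succ) := by
  obtain ⟨v, hv, rfl⟩ := hb
  exact map_isoComp_suffixRep_le _ _ _ (Submodule.mem_map_of_mem ((Submodule.mem_iInf _).1 hv j))

/-- The functions in `𝓕^w` are supported on words whose last letters are those of `w`. -/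
theorem suffixSpace_le_letterSpace {n k i : ℕ} (w : SuffixWord n k i) (p : Fin n)
    (hp : i ≤ p.val) (c : Letter) :
    suffixSpace w ≤ letterSpace n k p (w.1.getD (p.val - i) c) := by
  refine Submodule.span_mono (Set.image_mono fun x hx => ?_)
  have hw := w.2.1
  have hlt : p.val - i < w.1.length := by omega
  obtain ⟨u, hu⟩ : w.1 <:+ List.ofFn x.1 := hx
  have hlen : u.length = i := by
    have := congrArg List.length hu
    simp at this
    omega
  -- With $x=uw$ and $u$ of length $i$, place $p$ of $x$ is place $p-i$ of $w$. This index is in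
  -- range, so the default letter `c` never appears.
  have h : (u ++ w.1)[p.val]? = (List.ofFn x.1)[p.val]? := by rw [hu]
  rw [List.getElem?_append_right (hlen ▸ hp), hlen, List.getElem?_eq_getElem hlt,
    List.getElem?_eq_getElem (by simp)] at h
  simp only [List.getElem_ofFn, Option.some.injEq] at h
  rw [List.getD_eq_getElem _ _ hlt]
  exact h.symm

/-- The `j`-th diagram of a standard tableau has `j` boxes. -/
theorem StdTableau.card_chain {m : ℕ} (T : StdTableau m) (j : Fin (m + 1)) :
    (T.chain j).card = j.val := by
  induction j using Fin.induction with
  | zero => simp [T.chain_zero]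
  | succ j ih => simp [T.chain_card, ih]

end Johnson

theorem mainTheorem5 (n k i : ℕ) (hi : i + 1 ≤ n)
    (B B' : Set (Johnson.FunSpace n k))
    (hB : Johnson.IsIntermediateBasis n k i B)
    (hB' : Johnson.IsIntermediateBasis n k (i + 1) B')
    (b b' : Johnson.FunSpace n k) (hb : b ∈ B) (hb' : b' ∈ B')
    (h : Johnson.RSRelated i b b') :
    Johnson.Related hi b b' := by
  obtain ⟨l, l', hl, hl', P, P', c, -, -, hw, -, hchain⟩ := h
  -- Places count from 0, so $w'$ starts at place $i+1$. At earlier places the chosen letter is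
  -- arbitrary, since nothing is required there.
  refine ⟨fun j => l.tableau.chain j.succ,
    fun p => l'.word.1.getD (p.val - (i + 1)) c, fun j => l.tableau.card_chain j.succ, ?_⟩
  rintro v (rfl | rfl)
  · refine ⟨hl.mem_isoComp, fun p hp => ?_⟩
    obtain ⟨u, -, rfl⟩ := hl
    have hmem := Johnson.suffixSpace_le_letterSpace l.word p (by omega) c u.2
    -- The word of $b$ is $cw'$ and starts one place earlier, at $i$; dropping $c$ shifts the index
    -- by one.
    rwa [hw, show p.val - i = p.val - (i + 1) + 1 by omega, List.getD_cons_succ] at hmem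
  · refine ⟨fun j => ?_, fun p hp => ?_⟩
    -- Only the first $i$ groups matter, so the last diagram of $Q'$, the one with the added box, is
    -- never reached.
    · have hmem := hl'.mem_isoComp j.castSucc
      rwa [Fin.succ_castSucc, hchain] at hmem
    · obtain ⟨u, -, rfl⟩ := hl'
      exact Johnson.suffixSpace_le_letterSpace l'.word p hp c u.2
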